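/- All logarithms are to base $2$. Let $X,Y,Z$ be jointly distributed random variables with finite alphabets, and write $XZ=(X,Z)$, $YZ=(Y,Z)$. **Wyner-tension.** For random variables $A,B$ with finite alphabets and a given joint law, let $\mathfrak{T}_0(A;B)$ be the set of all $(r_1,r_2)\in\mathbb{R}_+^2$ for which there is a discrete random variable $Q$ jointly distributed with $(A,B)$ such that $I(B;Q|A)\le r_1$, $I(A;Q|B)\le r_2$ and $I(A;B|Q)\le 0$. Put $T_{\mathsf{Wyn}}(A;B)=\inf\{r_1+r_2:(r_1,r_2)\in\mathfrak{T}_0(A;B)\}$. **Protocols.** In a randomized two-party protocol $\Pi(X;Y)$ with private coins, party 1 has input $X$ and party 2 has input $Y$. The protocol fixes who sends first, and the parties then alternate sending messages, which are bit strings of arbitrary length. On its turn a party draws its next message together with an optional output from a distribution that depends only on its input and the messages exchanged so far. On producing an output a party halts: from then on it sends only empty messages. The number of rounds need not be bounded, but both parties halt almost surely. Messages are self-terminating: once the previous messages and the value of $X$ are fixed, the set of possible next messages (those of positive probability for some input pair in the support of $(X,Y)$ with that value of $X$) is prefix-free, and likewise with $Y$ in place of $X$. The transcript $M$ is the concatenation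 of all messages. Write $\Pi(X;Y)\mapsto(Z;Z)$ if the inputs and the two outputs of $\Pi$ have the same joint law as $(X,Y,Z,Z)$. **Information complexity.** The information complexity of computing $Z$ from $(X;Y)$ is $$\mathrm{IC}(Z)=\inf\{\,r_1+r_2 : (r_1,r_2)\in\mathbb{R}_+^2,\ \exists\,\Pi \text{ with } \Pi(X;Y)\mapsto(Z;Z),\ I(X;M|Y)\le r_1,\ I(Y;M|X)\le r_2\,\}.$$ **Claim.** For all such $X,Y,Z$, $$\mathrm{IC}(Z)\ \ge\ T_{\mathsf{Wyn}}(XZ;YZ)-T_{\mathsf{Wyn}}(X;Y).$$ In particular, if $X$ and $Y$ are independent of each other, then $\mathrm{IC}(Z)\ge T_{\mathsf{Wyn}}(XZ;YZ)$. -/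

import Mathlib

namespace Tension

/-- The conditional mutual information `I(A; B | C)`, in bits, of discrete random variables
`A`, `B`, `C` on a discrete probability space `(Ω, P)`:
`∑ p(a,b,c) log₂ (p(a,b,c) p(c) / (p(a,c) p(b,c)))`.
A term with `p(a,b,c) = 0` vanishes. The series converges absolutely as soon as one of `A`, `B`
takes finitely many values, which is the case wherever it is used below. -/
noncomputable def condMutualInfo {Ω α β γ : Type*} (P : PMF Ω)
    (A : Ω → α) (B : Ω → β) (C : Ω → γ) : ℝ :=
  ∑' w : α × β × γ,
    (P.map (fun ω => (A ω, B ω, C ω)) w).toReal *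
      Real.logb 2
        ((P.map (fun ω => (A ω, B ω, C ω)) w).toReal * (P.map C w.2.2).toReal /
          ((P.map (fun ω => (A ω, C ω)) (w.1, w.2.2)).toReal *
            (P.map (fun ω => (B ω, C ω)) w.2).toReal))

/-- The tension region of a pair `(A, B)` with joint law `p`: the triples `(r₁, r₂, r₃)` for which
there is a (discrete) random variable `Q` jointly distributed with `(A, B)` such that
`I(B; Q | A) ≤ r₁`, `I(A; Q | B) ≤ r₂` and `I(A; B | Q) ≤ r₃`.
The alphabet of `Q` is countable, hence without loss of generality `ℕ`. -/
def tensionRegion {α β : Type*} (p : PMF (α × β)) : Set (ℝ × ℝ × ℝ) :=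
  {r | ∃ P : PMF (α × β × ℕ), P.map (fun ω => (ω.1, ω.2.1)) = p ∧
    condMutualInfo P (fun ω => ω.2.1) (fun ω => ω.2.2) (fun ω => ω.1) ≤ r.1 ∧
    condMutualInfo P (fun ω => ω.1) (fun ω => ω.2.2) (fun ω => ω.2.1) ≤ r.2.1 ∧
    condMutualInfo P (fun ω => ω.1) (fun ω => ω.2.1) (fun ω => ω.2.2) ≤ r.2.2}

/-- The intersection of the tension region with the plane `r₃ = c`, in `ℝ₊²`. -/
def tensionSlice {α β : Type*} (p : PMF (α × β)) (c : ℝ) : Set (ℝ × ℝ) :=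
  {r | 0 ≤ r.1 ∧ 0 ≤ r.2 ∧ (r.1, r.2, c) ∈ tensionRegion p}

/-- The Wyner-tension `T_Wyn(A; B)` of a pair with joint law `p`. -/
noncomputable def wynerTension {α β : Type*} (p : PMF (α × β)) : ℝ :=
  sInf {t | ∃ r ∈ tensionSlice p 0, t = r.1 + r.2}

/-- A randomized two-party protocol with private coins. Party 1 has an input in `X` and an output
in `A`, party 2 has an input in `Y` and an output in `B`. The parties alternate sending messages,
which are bit strings. `first` is `true` if party 1 sends the first message. A party maps its
current view (its input and the messages exchanged so far) to a distribution over its next message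
together with an optional output. -/
structure Protocol (X Y A B : Type*) where
  first : Bool
  party1 : X → List (List Bool) → PMF (List Bool × Option A)
  party2 : Y → List (List Bool) → PMF (List Bool × Option B)

namespace Protocol

variable {X Y A B : Type*}

/-- It is party 1's turn after `n` messages. -/
def IsTurn1 (π : Protocol X Y A B) (n : ℕ) : Prop :=
  Even n ↔ π.first = true

open Classical in
/-- One move. A state consists of the messages exchanged so far and the outputs produced so far.
A party halts on producing an output: from then on it sends nothing (the empty message)
and its output is fixed. -/
noncomputable def step (π : Protocol X Y A B) (x : X) (y : Y)
    (s : List (List Bool) × Option A × Option B) :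
    PMF (List (List Bool) × Option A × Option B) :=
  if π.IsTurn1 s.1.length then
    match s.2.1 with
    | some a => PMF.pure (s.1 ++ [[]], some a, s.2.2)
    | none => (π.party1 x s.1).map (fun mo => (s.1 ++ [mo.1], mo.2, s.2.2))
  else
    match s.2.2 with
    | some b => PMF.pure (s.1 ++ [[]], s.2.1, some b)
    | none => (π.party2 y s.1).map (fun mo => (s.1 ++ [mo.1], s.2.1, mo.2))

/-- The law of the state after `n` moves on the inputs `x` and `y`. -/
noncomputable def run (π : Protocol X Y A B) (x : X) (y : Y) :
    ℕ → PMF (List (List Bool) × Option A × Option B)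
  | 0 => PMF.pure ([], none, none)
  | n + 1 => (π.run x y n).bind (π.step x y)

/-- The probability that, on the inputs `x` and `y`, both parties eventually halt with outputs
`a` and `b` and transcript `m`, the transcript being the concatenation of all messages. The
probability that this has happened within `n` moves is nondecreasing in `n`, since halted parties
send nothing. -/
noncomputable def outcomeProb (π : Protocol X Y A B) (x : X) (y : Y) (a : A) (b : B)
    (m : List Bool) : ENNReal :=
  ⨆ n : ℕ, (π.run x y n).map (fun s => (s.1.flatten, s.2)) (m, some a, some b)

/-- With positive probability, the messages of `π` on the inputs `x` and `y` begin with `τ`. -/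
def Reachable (π : Protocol X Y A B) (x : X) (y : Y) (τ : List (List Bool)) : Prop :=
  ∃ (a : Option A) (b : Option B), (τ, a, b) ∈ (π.run x y τ.length).support

/-- For inputs with joint law `p`, every message is self-terminating given the messages so far and
either one of the two inputs: the possible next messages are prefix-free once the previous
messages and `x` are fixed, and also once the previous messages and `y` are fixed. -/
def SelfTerminating (π : Protocol X Y A B) (p : PMF (X × Y)) : Prop :=
  ∀ (x x' : X) (y y' : Y), (x, y) ∈ p.support → (x', y') ∈ p.support → (x = x' ∨ y = y') →
    ∀ (τ : List (List Bool)) (m m' : List Bool),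
      π.Reachable x y (τ ++ [m]) → π.Reachable x' y' (τ ++ [m']) → m <+: m' → m = m'

/-- `P` is the joint law of the inputs, the outputs and the transcript `(X, Y, A, B, M)` when `π` is
run on inputs with joint law `p`. As `P` has total mass one, such a `P` exists only if both parties
halt almost surely. -/
def IsExecutionLaw (π : Protocol X Y A B) (p : PMF (X × Y))
    (P : PMF (X × Y × A × B × List Bool)) : Prop :=
  ∀ x y a b m, P (x, y, a, b, m) = p (x, y) * π.outcomeProb x y a b m

end Protocol

/-- The information complexity region for computing `(A; B)` from `(X; Y)`, where `q` is the joint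
law of `(X, Y, A, B)`: the pairs `(r₁, r₂)` in `ℝ₊²` for which there is a protocol which on input
`(X; Y)` outputs `(A; B)` and whose transcript `M` has `I(X; M | Y) ≤ r₁`, `I(Y; M | X) ≤ r₂`. -/
def infoRegion {X Y A B : Type*} (q : PMF (X × Y × A × B)) : Set (ℝ × ℝ) :=
  {r | 0 ≤ r.1 ∧ 0 ≤ r.2 ∧
    ∃ (π : Protocol X Y A B) (P : PMF (X × Y × A × B × List Bool)),
      π.SelfTerminating (q.map fun ω => (ω.1, ω.2.1)) ∧
      π.IsExecutionLaw (q.map fun ω => (ω.1, ω.2.1)) P ∧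
      P.map (fun ω => (ω.1, ω.2.1, ω.2.2.1, ω.2.2.2.1)) = q ∧
      condMutualInfo P (fun ω => ω.1) (fun ω => ω.2.2.2.2) (fun ω => ω.2.1) ≤ r.1 ∧
      condMutualInfo P (fun ω => ω.2.1) (fun ω => ω.2.2.2.2) (fun ω => ω.1) ≤ r.2}

/-- The information complexity of computing `Z` (as the common output of both parties) from
`(X; Y)`, where `p` is the joint law of `(X, Y, Z)`. -/
noncomputable def infoComplexity {X Y Z : Type*} (p : PMF (X × Y × Z)) : ℝ :=
  sInf {t | ∃ r ∈ infoRegion (p.map fun ω => (ω.1, ω.2.1, ω.2.2, ω.2.2)), t = r.1 + r.2}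

/-- The two coordinates of a pair with joint law `p` are independent. -/
def Independent {α β : Type*} (p : PMF (α × β)) : Prop :=
  ∀ a b, p (a, b) = p.map Prod.fst a * p.map Prod.snd b

end Tension

/-! Take a protocol with outputs `A = B = Z` almost surely and transcript `M`, and a variable `Q`
with `I(X;Y|Q) = 0`. Couple them so that `Q` and `(A, B, M)` are independent given `(X, Y)`. The
pair `(Q, M)` is then a witness for the Wyner-tension of `(XZ; YZ)`, with rates that are the sums of
those of `Q` and of the protocol; infima over both choices give the claim.

Independence of the views given `(Q, M)` is a rectangle argument. With private coins, the
probability of a message history is a function of party 1's view times one of party 2's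
(`exists_run_eq_mul`). The transcript only records the concatenation, but on a rectangle of possible
inputs self-termination forces a unique parsing (`SelfTerminating.eq_of_flatten_eq`), so the
two-by-two minors of the outcome probabilities vanish (`outcomeProb_mul_comm`). The inputs
compatible with a value of `Q` form such a rectangle, precisely because `I(X;Y|Q) = 0`.

For the rates (`condMutualInfo_pair_le`), the same rectangle property makes `Z` a function of `(Q,
M)`, and the chain rule gives `I(YZ; QM | XZ) = I(Y;Q|X) + I(Y;M|X) - I(Q;M|X) - I(Y;Z|X)`; the last
two terms are dropped. -/

namespace Tension

/-! ### Laws of discrete random variables as pushforwards. -/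

section Pushforward

variable {Ω κ : Type*}

theorem map_apply_eq_tsum_fiber (P : PMF Ω) (f : Ω → κ) (w : κ) :
    P.map f w = ∑' x : {x // f x = w}, P x := by
  classical
  rw [PMF.map_apply]
  refine Eq.trans (tsum_congr fun x => ?_) (tsum_subtype {x | f x = w} P).symm
  by_cases h : f x = w
  · simp [Set.indicator, h]
  · simp [Set.indicator, h, Ne.symm h]

theorem hasSum_fiber (P : PMF Ω) (f : Ω → κ) (w : κ) :
    HasSum (fun x : {x // f x = w} => (P x).toReal) (P.map f w).toReal := by
  have h : ∑' x : {x // f x = w}, P x ≠ ⊤ := by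
    rw [← map_apply_eq_tsum_fiber]; exact PMF.apply_ne_top _ _
  have := ENNReal.hasSum_toReal h
  rwa [← ENNReal.tsum_toReal_eq fun x => P.apply_ne_top _, ← map_apply_eq_tsum_fiber] at this

theorem summable_map_iff (P : PMF Ω) (f : Ω → κ) (φ : κ → ℝ) :
    Summable (fun w => (P.map f w).toReal * φ w) ↔
      Summable (fun ω => (P ω).toReal * φ (f ω)) := by
  have key : ∀ w, HasSum (fun x : {x // f x = w} => |(P x).toReal * φ (f x)|)
      |(P.map f w).toReal * φ w| := by
    intro w
    rw [abs_mul, abs_of_nonneg ENNReal.toReal_nonneg]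
    have e : (fun x : {x // f x = w} => |(P x).toReal * φ (f x)|) =
        fun x : {x // f x = w} => (P x).toReal * |φ w| :=
      funext fun x => by rw [abs_mul, abs_of_nonneg ENNReal.toReal_nonneg, x.2]
    rw [e]
    exact (hasSum_fiber P f w).mul_right |φ w|
  rw [← summable_abs_iff, ← summable_abs_iff (f := fun ω => (P ω).toReal * φ (f ω)),
    ← (Equiv.sigmaFiberEquiv f).summable_iff]
  refine Iff.trans ?_ (summable_sigma_of_nonneg fun _ => abs_nonneg _).symm
  constructor
  · intro h
    exact ⟨fun w => (key w).summable, h.congr fun w => ((key w).tsum_eq).symm⟩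
  · rintro ⟨-, h⟩
    exact h.congr fun w => ((key w).tsum_eq)

theorem tsum_map (P : PMF Ω) (f : Ω → κ) (φ : κ → ℝ) :
    ∑' w, (P.map f w).toReal * φ w = ∑' ω, (P ω).toReal * φ (f ω) := by
  by_cases h : Summable (fun ω => (P ω).toReal * φ (f ω))
  · have key : ∀ w, HasSum (fun x : {x // f x = w} => (P x).toReal * φ (f x))
        ((P.map f w).toReal * φ w) := by
      intro w
      have e : (fun x : {x // f x = w} => (P x).toReal * φ (f x)) =
          fun x : {x // f x = w} => (P x).toReal * φ w := funext fun x => by rw [x.2]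
      rw [e]
      exact (hasSum_fiber P f w).mul_right (φ w)
    rw [← (Equiv.sigmaFiberEquiv f).tsum_eq]
    refine Eq.trans ?_ ((Equiv.sigmaFiberEquiv f).summable_iff.2 h).tsum_sigma.symm
    exact tsum_congr fun w => ((key w).tsum_eq).symm
  -- Summability transfers across the map, so in the divergent case both sums take the default value
  -- 0.
  · rw [tsum_eq_zero_of_not_summable h, tsum_eq_zero_of_not_summable]
    rwa [summable_map_iff]

/-- The mass of an atom depends only on the event it names, up to null sets. This allows tuples to
be reordered and redundant coordinates to be dropped. -/
theorem map_apply_congr (P : PMF Ω) {κ' : Type*} (f : Ω → κ) (g : Ω → κ') (ω : Ω)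
    (h : ∀ ω' ∈ P.support, f ω' = f ω ↔ g ω' = g ω) : P.map f (f ω) = P.map g (g ω) := by
  classical
  rw [PMF.map_apply, PMF.map_apply]
  refine tsum_congr fun ω' => ?_
  by_cases hω : P ω' = 0
  · simp [hω]
  · have := h ω' hω
    simp only [eq_comm (a := f ω), eq_comm (a := g ω), this]

theorem map_apply_of_injective (P : PMF Ω) {f : Ω → κ} (hf : Function.Injective f) (ω : Ω) :
    P.map f (f ω) = P ω :=
  (map_apply_congr P f id ω fun _ _ => hf.eq_iff).trans (by rw [PMF.map_id]; rfl)

theorem map_apply_pos (P : PMF Ω) (f : Ω → κ) {ω : Ω} (h : P ω ≠ 0) :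
    0 < (P.map f (f ω)).toReal := by
  refine ENNReal.toReal_pos ?_ (PMF.apply_ne_top _ _)
  exact (PMF.mem_support_map_iff f P _).2 ⟨ω, h, rfl⟩

theorem map_snd_apply {α β : Type*} (Q : PMF (α × β)) (b : β) :
    Q.map Prod.snd b = ∑' a, Q (a, b) := by
  classical
  rw [PMF.map_apply, ENNReal.tsum_prod']
  refine tsum_congr fun a => ?_
  rw [tsum_eq_single b]
  · simp
  · intro b' hb
    simp [hb.symm]

theorem map_fst_apply {α β : Type*} (Q : PMF (α × β)) (a : α) :
    Q.map Prod.fst a = ∑' b, Q (a, b) := by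
  classical
  rw [PMF.map_apply, ENNReal.tsum_prod', tsum_eq_single a]
  · simp
  · intro b' hb
    simp [hb.symm]

theorem tsum_map_pair_left {α β : Type*} (P : PMF Ω) (A : Ω → α) (B : Ω → β) (b : β) :
    ∑' a, P.map (fun ω => (A ω, B ω)) (a, b) = P.map B b := by
  rw [← map_snd_apply, PMF.map_comp]; rfl

end Pushforward

/-! ### Conditional mutual information: summability, Gibbs' inequality, chain rule. -/

section Information

variable {Ω α β γ : Type*}

/-- The information density `i(A; B | C)`. -/
noncomputable def infoDensity (P : PMF Ω) (A : Ω → α) (B : Ω → β) (C : Ω → γ) (ω : Ω) : ℝ :=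
  Real.logb 2
    ((P.map (fun ω => (A ω, B ω, C ω)) (A ω, B ω, C ω)).toReal * (P.map C (C ω)).toReal /
      ((P.map (fun ω => (A ω, C ω)) (A ω, C ω)).toReal *
        (P.map (fun ω => (B ω, C ω)) (B ω, C ω)).toReal))

theorem condMutualInfo_eq_tsum (P : PMF Ω) (A : Ω → α) (B : Ω → β) (C : Ω → γ) :
    condMutualInfo P A B C = ∑' ω, (P ω).toReal * infoDensity P A B C ω :=
  tsum_map P (fun ω => (A ω, B ω, C ω)) fun w => Real.logb 2
    ((P.map (fun ω => (A ω, B ω, C ω)) w).toReal * (P.map C w.2.2).toReal /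
      ((P.map (fun ω => (A ω, C ω)) (w.1, w.2.2)).toReal *
        (P.map (fun ω => (B ω, C ω)) w.2).toReal))

theorem condMutualInfo_map {Ω' : Type*} (P : PMF Ω') (f : Ω' → Ω) (A : Ω → α) (B : Ω → β)
    (C : Ω → γ) :
    condMutualInfo (P.map f) A B C =
      condMutualInfo P (fun ω => A (f ω)) (fun ω => B (f ω)) (fun ω => C (f ω)) := by
  simp only [condMutualInfo, PMF.map_comp]; rfl

theorem map_pair_le (P : PMF Ω) (A : Ω → α) (C : Ω → γ) (a : α) (c : γ) :
    P.map (fun ω => (A ω, C ω)) (a, c) ≤ P.map C c := by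
  rw [← tsum_map_pair_left P A C]
  exact ENNReal.le_tsum a

theorem mul_log_div_bounds {x y : ℝ} (hx : 0 ≤ x) (hxy : x ≤ y) :
    0 ≤ x * Real.logb 2 (y / x) ∧ x * Real.logb 2 (y / x) ≤ y / Real.log 2 := by
  have h2 : 0 < Real.log 2 := Real.log_pos one_lt_two
  rcases hx.eq_or_lt with rfl | hx
  · simp only [zero_mul, le_refl, true_and]; positivity
  · have h1 : 1 ≤ y / x := (one_le_div hx).2 hxy
    refine ⟨mul_nonneg hx.le (Real.logb_nonneg one_lt_two h1), ?_⟩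
    rw [Real.logb, ← mul_div_assoc]
    refine div_le_div_of_nonneg_right ?_ h2.le
    have := Real.log_le_sub_one_of_pos (zero_lt_one.trans_le h1)
    calc x * Real.log (y / x) ≤ x * (y / x - 1) := by gcongr
      _ = y - x := by field_simp
      _ ≤ y := by linarith

theorem summable_toReal (P : PMF Ω) : Summable fun ω => (P ω).toReal :=
  ENNReal.summable_toReal P.tsum_coe_ne_top

/-- Each term `p(a,c) log (p(c)/p(a,c))` is at most a constant times `p(c)`, which is summable over
`γ` and over the finite alphabet `α`. -/
theorem summable_condEntropy [Finite α] (P : PMF Ω) (A : Ω → α) (C : Ω → γ) :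
    Summable fun ω => (P ω).toReal *
      Real.logb 2 ((P.map C (C ω)).toReal / (P.map (fun ω => (A ω, C ω)) (A ω, C ω)).toReal) := by
  have := Fintype.ofFinite α
  refine (summable_map_iff P (fun ω => (A ω, C ω)) fun w => Real.logb 2
    ((P.map C w.2).toReal / (P.map (fun ω => (A ω, C ω)) w).toReal)).1 ?_
  have hb : ∀ w : α × γ, _ := fun w => mul_log_div_bounds
    (x := (P.map (fun ω => (A ω, C ω)) w).toReal) (y := (P.map C w.2).toReal)
    ENNReal.toReal_nonneg (ENNReal.toReal_mono (PMF.apply_ne_top _ _) (map_pair_le P A C w.1 w.2))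
  refine Summable.of_nonneg_of_le (fun w => (hb w).1) (fun w => (hb w).2) ?_
  refine Summable.div_const ?_ _
  refine (summable_prod_of_nonneg fun _ => ENNReal.toReal_nonneg).2 ⟨fun a => ?_, ?_⟩
  · exact summable_toReal _
  · exact Summable.of_finite

/-- This is `I(A;B|C) = H(A|C) - H(A|B,C)` at the level of densities. -/
theorem summable_infoDensity [Finite α] (P : PMF Ω) (A : Ω → α) (B : Ω → β) (C : Ω → γ) :
    Summable fun ω => (P ω).toReal * infoDensity P A B C ω := by
  refine ((summable_condEntropy P A C).sub
    (summable_condEntropy P A fun ω => (B ω, C ω))).congr fun ω => ?_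
  by_cases h : P ω = 0
  · simp [h]
  have h1 := map_apply_pos P C h
  have h2 := map_apply_pos P (fun ω => (A ω, C ω)) h
  have h3 := map_apply_pos P (fun ω => (B ω, C ω)) h
  have h4 := map_apply_pos P (fun ω => (A ω, B ω, C ω)) h
  rw [infoDensity, ← mul_sub, ← Real.logb_div (by positivity) (by positivity)]
  congr 2
  field_simp

theorem gibbs {ι : Type*} {f g : ι → ℝ} (hf : ∀ i, 0 ≤ f i) (hg : ∀ i, 0 ≤ g i)
    (hfg : ∀ i, f i ≠ 0 → g i ≠ 0) (sf : Summable f) (sg : Summable g)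
    (hle : ∑' i, g i ≤ ∑' i, f i) (s : Summable fun i => f i * Real.logb 2 (f i / g i)) :
    0 ≤ ∑' i, f i * Real.logb 2 (f i / g i) ∧
      (∑' i, f i * Real.logb 2 (f i / g i) ≤ 0 → ∀ i, f i = g i) := by
  have h2 : 0 < Real.log 2 := Real.log_pos one_lt_two
  -- The termwise defect in `log t ≤ t - 1` at `t = g/f`. It is nonnegative and vanishes only when
  -- `f = g`, and its sum is the divergence in nats minus `∑ f - ∑ g`.
  let d : ι → ℝ := fun i => Real.log 2 * (f i * Real.logb 2 (f i / g i)) - (f i - g i)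
  have hd : ∀ i, 0 ≤ d i ∧ (d i = 0 → f i = g i) := by
    intro i
    by_cases h0 : f i = 0
    · simp only [d, h0]; simp [hg i, eq_comm]
    have fp : 0 < f i := (hf i).lt_of_ne' h0
    have gp : 0 < g i := (hg i).lt_of_ne' (hfg i h0)
    have e : d i = f i * (g i / f i - 1 - Real.log (g i / f i)) := by
      have : Real.log (f i / g i) = - Real.log (g i / f i) := by
        rw [← Real.log_inv, inv_div]
      simp only [d, Real.logb, this]
      field_simp
      ring
    have hq : 0 < g i / f i := div_pos gp fp
    rw [e]
    refine ⟨mul_nonneg fp.le (by linarith [Real.log_le_sub_one_of_pos hq]), fun h => ?_⟩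
    by_contra hne
    have : g i / f i ≠ 1 := fun h => hne ((div_eq_one_iff_eq h0).1 h).symm
    have := Real.log_lt_sub_one_of_pos hq this
    rcases mul_eq_zero.1 h with h | h
    · exact h0 h
    · linarith
  have sd : Summable d := (s.mul_left _).sub (sf.sub sg)
  have td : ∑' i, d i = Real.log 2 * ∑' i, f i * Real.logb 2 (f i / g i) -
      (∑' i, f i - ∑' i, g i) := by
    rw [(s.mul_left _).tsum_sub (sf.sub sg), sf.tsum_sub sg, tsum_mul_left]
  have nd : 0 ≤ ∑' i, d i := tsum_nonneg fun i => (hd i).1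
  refine ⟨?_, fun h i => ?_⟩
  · by_contra! h
    nlinarith
  · have : ∑' i, d i = 0 := le_antisymm (by nlinarith) nd
    exact (hd i).2 (congrFun ((hasSum_zero_iff_of_nonneg fun i => (hd i).1).1
      (this ▸ sd.hasSum)) i)

/-- The reference measure `p(a,c) p(b,c) / p(c)` for Gibbs' inequality. The bound `≤ 1` suffices
there and avoids a case split on `p(c) = 0`. -/
theorem tsum_product_law_le_one (P : PMF Ω) (A : Ω → α) (B : Ω → β) (C : Ω → γ) :
    ∑' w : α × β × γ, P.map (fun ω => (A ω, C ω)) (w.1, w.2.2) *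
      P.map (fun ω => (B ω, C ω)) w.2 / P.map C w.2.2 ≤ 1 := by
  calc _ = ∑' (b : β) (c : γ) (a : α), P.map (fun ω => (A ω, C ω)) (a, c) *
          (P.map (fun ω => (B ω, C ω)) (b, c) / P.map C c) := by
        rw [ENNReal.tsum_prod', ENNReal.tsum_comm, ENNReal.tsum_prod']
        simp only [mul_div_assoc]
    _ = ∑' (b : β) (c : γ), P.map C c *
          (P.map (fun ω => (B ω, C ω)) (b, c) / P.map C c) := by
        simp only [ENNReal.tsum_mul_right, tsum_map_pair_left]
    _ ≤ ∑' (b : β) (c : γ), P.map (fun ω => (B ω, C ω)) (b, c) := by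
        refine ENNReal.tsum_le_tsum fun b => ENNReal.tsum_le_tsum fun c => ENNReal.mul_div_le
    _ = 1 := by rw [← ENNReal.tsum_prod', PMF.tsum_coe]

theorem condMutualInfo_gibbs (P : PMF Ω) (A : Ω → α) (B : Ω → β) (C : Ω → γ)
    (s : Summable fun ω => (P ω).toReal * infoDensity P A B C ω) :
    0 ≤ condMutualInfo P A B C ∧ (condMutualInfo P A B C ≤ 0 → ∀ a b c,
      P.map (fun ω => (A ω, B ω, C ω)) (a, b, c) * P.map C c =
        P.map (fun ω => (A ω, C ω)) (a, c) * P.map (fun ω => (B ω, C ω)) (b, c)) := by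
  let G : α × β × γ → ENNReal := fun w => P.map (fun ω => (A ω, C ω)) (w.1, w.2.2) *
      P.map (fun ω => (B ω, C ω)) w.2 / P.map C w.2.2
  have hG : ∑' w, G w ≤ 1 := tsum_product_law_le_one P A B C
  have hGt : ∑' w, G w ≠ ⊤ := (hG.trans_lt ENNReal.one_lt_top).ne
  have s' := (summable_map_iff P (fun ω => (A ω, B ω, C ω)) fun w => Real.logb 2
    ((P.map (fun ω => (A ω, B ω, C ω)) w).toReal * (P.map C w.2.2).toReal /
      ((P.map (fun ω => (A ω, C ω)) (w.1, w.2.2)).toReal *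
        (P.map (fun ω => (B ω, C ω)) w.2).toReal))).2 s
  have e : ∀ w : α × β × γ, (P.map (fun ω => (A ω, B ω, C ω)) w).toReal *
      (P.map C w.2.2).toReal / ((P.map (fun ω => (A ω, C ω)) (w.1, w.2.2)).toReal *
        (P.map (fun ω => (B ω, C ω)) w.2).toReal) =
      (P.map (fun ω => (A ω, B ω, C ω)) w).toReal / (G w).toReal := by
    intro w
    simp only [G, ENNReal.toReal_div, ENNReal.toReal_mul]
    rw [div_div_eq_mul_div]
  have hpos : ∀ w : α × β × γ, P.map (fun ω => (A ω, B ω, C ω)) w ≠ 0 →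
      P.map (fun ω => (A ω, C ω)) (w.1, w.2.2) ≠ 0 ∧
      P.map (fun ω => (B ω, C ω)) w.2 ≠ 0 ∧ P.map C w.2.2 ≠ 0 := by
    intro w hw
    obtain ⟨ω, hω, rfl⟩ := (PMF.mem_support_map_iff _ _ _).1 hw
    exact ⟨(PMF.mem_support_map_iff _ _ _).2 ⟨ω, hω, rfl⟩,
      (PMF.mem_support_map_iff _ _ _).2 ⟨ω, hω, rfl⟩,
      (PMF.mem_support_map_iff _ _ _).2 ⟨ω, hω, rfl⟩⟩
  have hGf : ∀ w, G w ≠ ⊤ := fun w => ENNReal.ne_top_of_tsum_ne_top hGt w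
  simp only [e] at s'
  have key := gibbs (f := fun w => (P.map (fun ω => (A ω, B ω, C ω)) w).toReal)
    (g := fun w => (G w).toReal) (fun _ => ENNReal.toReal_nonneg)
    (fun _ => ENNReal.toReal_nonneg) (fun w hw => by
      obtain ⟨h1, h2, h3⟩ := hpos w fun h => hw (by simp [h])
      refine (ENNReal.toReal_pos ?_ (hGf w)).ne'
      exact ENNReal.div_ne_zero.2 ⟨mul_ne_zero h1 h2, PMF.apply_ne_top _ _⟩)
    (summable_toReal _) (ENNReal.summable_toReal hGt) (by
      rw [← ENNReal.tsum_toReal_eq hGf, ← ENNReal.tsum_toReal_eq fun w => PMF.apply_ne_top _ w,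
        PMF.tsum_coe]
      exact ENNReal.toReal_mono ENNReal.one_ne_top hG) s'
  simp only [condMutualInfo, e]
  refine ⟨key.1, fun h a b c => ?_⟩
  have hw : P.map (fun ω => (A ω, B ω, C ω)) (a, b, c) = G (a, b, c) :=
    (ENNReal.toReal_eq_toReal_iff' (PMF.apply_ne_top _ _) (hGf _)).1 (key.2 h (a, b, c))
  rw [hw]
  by_cases h0 : P.map C c = 0
  · have := map_pair_le P A C a c
    rw [h0, nonpos_iff_eq_zero] at this
    simp [h0, this]
  · exact ENNReal.div_mul_cancel h0 (PMF.apply_ne_top _ _)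

theorem condMutualInfo_nonneg (P : PMF Ω) (A : Ω → α) (B : Ω → β) (C : Ω → γ) :
    0 ≤ condMutualInfo P A B C := by
  by_cases s : Summable fun ω => (P ω).toReal * infoDensity P A B C ω
  · exact (condMutualInfo_gibbs P A B C s).1
  -- A divergent series has value 0, so no finiteness of alphabets is needed; the lemma can be
  -- applied to `I(Q;M|X)` with both `Q` and `M` infinite.
  · rw [condMutualInfo_eq_tsum, tsum_eq_zero_of_not_summable s]

theorem map_mul_map_of_condMutualInfo_nonpos [Finite α] (P : PMF Ω) (A : Ω → α) (B : Ω → β)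
    (C : Ω → γ) (h : condMutualInfo P A B C ≤ 0) (a : α) (b : β) (c : γ) :
    P.map (fun ω => (A ω, B ω, C ω)) (a, b, c) * P.map C c =
      P.map (fun ω => (A ω, C ω)) (a, c) * P.map (fun ω => (B ω, C ω)) (b, c) :=
  (condMutualInfo_gibbs P A B C (summable_infoDensity P A B C)).2 h a b c

theorem condMutualInfo_eq_zero (P : PMF Ω) (A : Ω → α) (B : Ω → β) (C : Ω → γ)
    (h : ∀ a b c, P.map (fun ω => (A ω, B ω, C ω)) (a, b, c) * P.map C c =
      P.map (fun ω => (A ω, C ω)) (a, c) * P.map (fun ω => (B ω, C ω)) (b, c)) :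
    condMutualInfo P A B C = 0 := by
  rw [condMutualInfo]
  convert tsum_zero with w
  rw [← ENNReal.toReal_mul, ← ENNReal.toReal_mul, h w.1 w.2.1 w.2.2]
  rcases eq_or_ne (P.map (fun ω => (A ω, C ω)) (w.1, w.2.2) *
    P.map (fun ω => (B ω, C ω)) (w.2.1, w.2.2)).toReal 0 with h0 | h0
  · rw [h0, div_zero, Real.logb_zero, mul_zero]
  · rw [div_self h0, Real.logb_one, mul_zero]

/-- A law whose two-by-two minors vanish given `C` has conditionally independent components. -/
theorem condMutualInfo_eq_zero_of_minors (P : PMF Ω) (A : Ω → α) (B : Ω → β) (C : Ω → γ)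
    (h : ∀ a b a' b' c, P.map (fun ω => (A ω, B ω, C ω)) (a, b, c) *
        P.map (fun ω => (A ω, B ω, C ω)) (a', b', c) =
      P.map (fun ω => (A ω, B ω, C ω)) (a, b', c) *
        P.map (fun ω => (A ω, B ω, C ω)) (a', b, c)) :
    condMutualInfo P A B C = 0 := by
  have hA : ∀ a c, ∑' b, P.map (fun ω => (A ω, B ω, C ω)) (a, b, c) =
      P.map (fun ω => (A ω, C ω)) (a, c) := by
    intro a c
    rw [← tsum_map_pair_left P B (fun ω => (A ω, C ω))]
    refine tsum_congr fun b => ?_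
    have := map_apply_of_injective (P.map fun ω => (A ω, B ω, C ω))
      (f := fun w => (w.2.1, w.1, w.2.2)) (fun v w h => by simp_all [Prod.ext_iff]) (a, b, c)
    rw [← this, PMF.map_comp]
    rfl
  have hB : ∀ b c, ∑' a, P.map (fun ω => (A ω, B ω, C ω)) (a, b, c) =
      P.map (fun ω => (B ω, C ω)) (b, c) :=
    fun b c => tsum_map_pair_left P A (fun ω => (B ω, C ω)) (b, c)
  have hC : ∀ c, ∑' (a) (b), P.map (fun ω => (A ω, B ω, C ω)) (a, b, c) = P.map C c := by
    intro c
    simp only [hA, tsum_map_pair_left]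
  refine condMutualInfo_eq_zero P A B C fun a b c => ?_
  rw [← hC c, ← hA a c, ← hB b c]
  -- Summing the minor identity over `a'` and `b'` turns it into `p(a,b,c) p(c) = p(a,c) p(b,c)`.
  simp only [← ENNReal.tsum_mul_left, ← ENNReal.tsum_mul_right, h a b]

/-- Extending a conditioning variable `X` by `A`, a function of `(Q, M)`, and the revealed variable
to the pair `N` of `(Q, M)`, where `Q` and `M` are independent given `(X, Y)`. -/
theorem condMutualInfo_pair_le {ζ θ μ ν υ : Type*} [Finite α] [Finite ζ] (P : PMF Ω)
    (X : Ω → γ) (Y : Ω → α) (A B : Ω → ζ) (Q : Ω → θ) (M : Ω → μ) (N : Ω → ν) (V : Ω → υ)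
    (hAB : ∀ ω ∈ P.support, A ω = B ω)
    (hA : ∀ ω ∈ P.support, ∀ ω' ∈ P.support, Q ω = Q ω' → M ω = M ω' → A ω = A ω')
    (hN : ∀ ω ω', N ω = N ω' ↔ Q ω = Q ω' ∧ M ω = M ω')
    (hV : ∀ ω ω', V ω = V ω' ↔ X ω = X ω' ∧ Y ω = Y ω')
    (hQM : ∀ ω, P.map (fun ω => (V ω, Q ω, M ω)) (V ω, Q ω, M ω) * P.map V (V ω) =
      P.map (fun ω => (V ω, Q ω)) (V ω, Q ω) * P.map (fun ω => (V ω, M ω)) (V ω, M ω)) :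
    condMutualInfo P (fun ω => (Y ω, B ω)) N (fun ω => (X ω, A ω)) ≤
      condMutualInfo P Y Q X + condMutualInfo P Y M X := by
  -- The chain rule holds pointwise for densities. Stating it with the `(Q, M)` density alone on the
  -- left means that only the four series on the right, each with a finite alphabet, must be shown
  -- summable.
  have key : ∀ ω, (P ω).toReal * infoDensity P Q M X ω =
      (P ω).toReal * infoDensity P Y Q X ω + (P ω).toReal * infoDensity P Y M X ω -
        (P ω).toReal * infoDensity P Y A X ω -
        (P ω).toReal * infoDensity P (fun ω => (Y ω, B ω)) N (fun ω => (X ω, A ω)) ω := by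
    intro ω
    by_cases h : P ω = 0
    · simp [h]
    have e1 : P.map (fun ω => ((Y ω, B ω), N ω, (X ω, A ω))) ((Y ω, B ω), N ω, (X ω, A ω)) =
        P.map (fun ω => (V ω, Q ω, M ω)) (V ω, Q ω, M ω) :=
      map_apply_congr P _ _ ω fun ω' h' => by
        have := hA ω' h' ω h
        simp only [Prod.ext_iff, hN, hV, ← hAB ω h, ← hAB ω' h']
        tauto
    have e2 : P.map (fun ω => ((Y ω, B ω), (X ω, A ω))) ((Y ω, B ω), (X ω, A ω)) =
        P.map (fun ω => (Y ω, A ω, X ω)) (Y ω, A ω, X ω) :=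
      map_apply_congr P _ _ ω fun ω' h' => by
        simp only [Prod.ext_iff, ← hAB ω h, ← hAB ω' h']
        tauto
    have e3 : P.map (fun ω => (N ω, (X ω, A ω))) (N ω, (X ω, A ω)) =
        P.map (fun ω => (Q ω, M ω, X ω)) (Q ω, M ω, X ω) :=
      map_apply_congr P _ _ ω fun ω' h' => by
        have := hA ω' h' ω h
        simp only [Prod.ext_iff, hN]
        tauto
    have e4 : P.map (fun ω => (X ω, A ω)) (X ω, A ω) = P.map (fun ω => (A ω, X ω)) (A ω, X ω) :=
      map_apply_congr P _ _ ω fun ω' h' => by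
        simp only [Prod.ext_iff]
        tauto
    have e5 : P.map V (V ω) = P.map (fun ω => (Y ω, X ω)) (Y ω, X ω) :=
      map_apply_congr P _ _ ω fun ω' h' => by
        simp only [Prod.ext_iff, hV]
        tauto
    have e6 : P.map (fun ω => (V ω, Q ω)) (V ω, Q ω) =
        P.map (fun ω => (Y ω, Q ω, X ω)) (Y ω, Q ω, X ω) :=
      map_apply_congr P _ _ ω fun ω' h' => by
        simp only [Prod.ext_iff, hV]
        tauto
    have e7 : P.map (fun ω => (V ω, M ω)) (V ω, M ω) =
        P.map (fun ω => (Y ω, M ω, X ω)) (Y ω, M ω, X ω) :=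
      map_apply_congr P _ _ ω fun ω' h' => by
        simp only [Prod.ext_iff, hV]
        tauto
    have m := congrArg ENNReal.toReal (hQM ω)
    rw [e5, e6, e7, ENNReal.toReal_mul, ENNReal.toReal_mul] at m
    simp only [infoDensity, e1, e2, e3, e4]
    have p1 := map_apply_pos P (fun ω => (V ω, Q ω, M ω)) h
    have p2 := map_apply_pos P (fun ω => (Y ω, A ω, X ω)) h
    have p3 := map_apply_pos P (fun ω => (Q ω, M ω, X ω)) h
    have p4 := map_apply_pos P (fun ω => (A ω, X ω)) h
    have p5 := map_apply_pos P (fun ω => (Y ω, X ω)) h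
    have p6 := map_apply_pos P (fun ω => (Y ω, Q ω, X ω)) h
    have p7 := map_apply_pos P (fun ω => (Y ω, M ω, X ω)) h
    have p8 := map_apply_pos P (fun ω => (Q ω, X ω)) h
    have p9 := map_apply_pos P (fun ω => (M ω, X ω)) h
    have p10 := map_apply_pos P X h
    rw [← mul_add, ← mul_sub, ← mul_sub, ← Real.logb_mul (by positivity) (by positivity),
      ← Real.logb_div (by positivity) (by positivity),
      ← Real.logb_div (by positivity) (by positivity)]
    congr 2
    rw [eq_div_of_mul_eq p5.ne' m]
    field_simp
  have s1 := summable_infoDensity P Y Q X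
  have s2 := summable_infoDensity P Y M X
  have s3 := summable_infoDensity P Y A X
  have s4 := summable_infoDensity P (fun ω => (Y ω, B ω)) N (fun ω => (X ω, A ω))
  have t := tsum_congr (L := .unconditional Ω) key
  rw [((s1.add s2).sub s3).tsum_sub s4, (s1.add s2).tsum_sub s3, s1.tsum_add s2] at t
  simp only [← condMutualInfo_eq_tsum] at t
  linarith [condMutualInfo_nonneg P Q M X, condMutualInfo_nonneg P Y A X]

end Information

end Tension

/-! ### The rectangle property of protocols and unique parsing of transcripts. -/

namespace Tension

namespace Protocol

variable {X Y A B : Type*}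

open Classical in
/-- The probability that a party with state `a` (its output so far) sends `m` and moves to the
next state, where `μ` is the law of its next move if it has not halted. -/
noncomputable def moveProb {A : Type*} (μ : PMF (List Bool × Option A)) (a : Option A)
    (m : List Bool) (a' : Option A) : ENNReal :=
  match a with
  | some a₀ => if m = [] ∧ a' = some a₀ then 1 else 0
  | none => μ (m, a')

open Classical in
theorem step_apply_append (π : Protocol X Y A B) (x : X) (y : Y) (τ : List (List Bool))
    (a a' : Option A) (b b' : Option B) (m : List Bool) :
    π.step x y (τ, a, b) (τ ++ [m], a', b') =
      if π.IsTurn1 τ.length then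
        if b' = b then moveProb (π.party1 x τ) a m a' else 0
      else if a' = a then moveProb (π.party2 y τ) b m b' else 0 := by
  unfold step
  dsimp only
  split_ifs with h hb ha
  · subst hb
    cases a with
    | some a₀ => simp [moveProb]
    | none =>
      exact map_apply_of_injective (π.party1 x τ) (f := fun mo => (τ ++ [mo.1], mo.2, b'))
        (fun u v h => by simpa [Prod.ext_iff] using h) (m, a')
  · cases a with
    | some a₀ => simp [hb]
    | none => simp [hb]
  · subst ha
    cases b with
    | some b₀ => simp [moveProb]
    | none =>
      exact map_apply_of_injective (π.party2 y τ) (f := fun mo => (τ ++ [mo.1], a', mo.2))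
        (fun u v h => by simpa [Prod.ext_iff] using h) (m, b')
  · cases b with
    | some a₀ => simp [ha]
    | none => simp [ha]

theorem exists_append_of_mem_support_step (π : Protocol X Y A B) (x : X) (y : Y)
    (s s' : List (List Bool) × Option A × Option B) (h : s' ∈ (π.step x y s).support) :
    ∃ m, s'.1 = s.1 ++ [m] := by
  unfold step at h
  split_ifs at h with ht
  · split at h
    · rw [PMF.mem_support_pure_iff] at h
      exact ⟨[], by rw [h]⟩
    · obtain ⟨w, -, rfl⟩ := (PMF.mem_support_map_iff _ _ _).1 h
      exact ⟨w.1, rfl⟩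
  · split at h
    · rw [PMF.mem_support_pure_iff] at h
      exact ⟨[], by rw [h]⟩
    · obtain ⟨w, -, rfl⟩ := (PMF.mem_support_map_iff _ _ _).1 h
      exact ⟨w.1, rfl⟩

theorem step_apply_eq_zero (π : Protocol X Y A B) (x : X) (y : Y)
    (s s' : List (List Bool) × Option A × Option B) (h : ∀ m, s'.1 ≠ s.1 ++ [m]) :
    π.step x y s s' = 0 := by
  by_contra h0
  obtain ⟨m, hm⟩ := π.exists_append_of_mem_support_step x y s s' h0
  exact h m hm

theorem run_succ_nil (π : Protocol X Y A B) (x : X) (y : Y) (n : ℕ)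
    (a : Option A) (b : Option B) : π.run x y (n + 1) ([], a, b) = 0 := by
  rw [run, PMF.bind_apply, ENNReal.tsum_eq_zero]
  intro s
  rw [step_apply_eq_zero _ _ _ _ _ (by simp), mul_zero]

theorem run_succ_append (π : Protocol X Y A B) (x : X) (y : Y) (n : ℕ) (τ : List (List Bool))
    (m : List Bool) (a' : Option A) (b' : Option B) :
    π.run x y (n + 1) (τ ++ [m], a', b') =
      ∑' (a) (b), π.run x y n (τ, a, b) * π.step x y (τ, a, b) (τ ++ [m], a', b') := by
  rw [run, PMF.bind_apply, ENNReal.tsum_prod', tsum_eq_single τ, ENNReal.tsum_prod']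
  intro τ' h
  rw [ENNReal.tsum_eq_zero]
  intro s
  rw [step_apply_eq_zero, mul_zero]
  intro m' h'
  exact h (List.append_inj_left' h' rfl).symm

theorem run_succ_append_of_isTurn1 (π : Protocol X Y A B) (x : X) (y : Y) (n : ℕ)
    (τ : List (List Bool)) (m : List Bool) (a' : Option A) (b' : Option B)
    (h : π.IsTurn1 τ.length) :
    π.run x y (n + 1) (τ ++ [m], a', b') =
      ∑' a, π.run x y n (τ, a, b') * moveProb (π.party1 x τ) a m a' := by
  rw [run_succ_append]
  refine tsum_congr fun a => ?_
  rw [tsum_eq_single b']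
  · rw [step_apply_append, if_pos h, if_pos rfl]
  · intro b hb
    rw [step_apply_append, if_pos h, if_neg hb.symm, mul_zero]

theorem run_succ_append_of_not_isTurn1 (π : Protocol X Y A B) (x : X) (y : Y) (n : ℕ)
    (τ : List (List Bool)) (m : List Bool) (a' : Option A) (b' : Option B)
    (h : ¬ π.IsTurn1 τ.length) :
    π.run x y (n + 1) (τ ++ [m], a', b') =
      ∑' b, π.run x y n (τ, a', b) * moveProb (π.party2 y τ) b m b' := by
  rw [run_succ_append, tsum_eq_single a']
  · refine tsum_congr fun b => ?_
    rw [step_apply_append, if_neg h, if_pos rfl]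
  · intro a ha
    rw [ENNReal.tsum_eq_zero]
    intro b
    rw [step_apply_append, if_neg h, if_neg ha.symm, mul_zero]

open Classical in
/-- The law of the state after `n` moves is a product of a function of party 1's view and one of
party 2's view. -/
theorem exists_run_eq_mul (π : Protocol X Y A B) (n : ℕ) :
    ∃ (F : X → List (List Bool) → Option A → ENNReal)
      (G : Y → List (List Bool) → Option B → ENNReal),
      ∀ x y τ a b, π.run x y n (τ, a, b) = F x τ a * G y τ b := by
  induction n with
  | zero =>
    refine ⟨fun _ τ a => if τ = [] ∧ a = none then 1 else 0,
      fun _ _ b => if b = none then 1 else 0, fun x y τ a b => ?_⟩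
    rw [run, PMF.pure_apply]
    by_cases h1 : τ = [] <;> by_cases h2 : a = none <;> by_cases h3 : b = none <;>
      simp [h1, h2, h3]
  | succ n ih =>
    obtain ⟨F, G, h⟩ := ih
    -- The last message updates only the factor of the party that sent it. The empty history is
    -- impossible after a move, and it suffices that one factor vanishes there.
    refine ⟨fun x τ a' => if τ = [] then 0 else if π.IsTurn1 τ.dropLast.length then
        ∑' a, F x τ.dropLast a * moveProb (π.party1 x τ.dropLast) a (τ.getLastD []) a'
          else F x τ.dropLast a',
      fun y τ b' => if π.IsTurn1 τ.dropLast.length then G y τ.dropLast b' else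
        ∑' b, G y τ.dropLast b * moveProb (π.party2 y τ.dropLast) b (τ.getLastD []) b',
      fun x y τ a' b' => ?_⟩
    rcases List.eq_nil_or_concat τ with rfl | ⟨σ, m, rfl⟩
    · simp [run_succ_nil]
    · rw [List.concat_eq_append]
      have h1 : (σ ++ [m]).dropLast = σ := List.dropLast_concat
      have h2 : (σ ++ [m]).getLastD [] = m := by simp
      have h3 : σ ++ [m] ≠ [] := by simp
      simp only [h1, h2, if_neg h3]
      by_cases ht : π.IsTurn1 σ.length
      · rw [run_succ_append_of_isTurn1 _ _ _ _ _ _ _ _ ht, if_pos ht, if_pos ht,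
          ← ENNReal.tsum_mul_right]
        refine tsum_congr fun a => ?_
        rw [h, mul_right_comm]
      · rw [run_succ_append_of_not_isTurn1 _ _ _ _ _ _ _ _ ht, if_neg ht, if_neg ht,
          ← ENNReal.tsum_mul_left]
        refine tsum_congr fun b => ?_
        rw [h, mul_assoc]

theorem length_of_mem_support_run (π : Protocol X Y A B) (x : X) (y : Y) (n : ℕ)
    (s : List (List Bool) × Option A × Option B) (h : s ∈ (π.run x y n).support) :
    s.1.length = n := by
  induction n generalizing s with
  | zero =>
    rw [run, PMF.mem_support_pure_iff] at h
    simp [h]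
  | succ n ih =>
    obtain ⟨s', h', hs⟩ := (PMF.mem_support_bind_iff _ _ _).1 h
    obtain ⟨m, hm⟩ := π.exists_append_of_mem_support_step x y s' s hs
    rw [hm, List.length_append, ih s' h']
    rfl

theorem reachable_of_mem_support_run (π : Protocol X Y A B) (x : X) (y : Y) (n : ℕ)
    (s : List (List Bool) × Option A × Option B) (h : s ∈ (π.run x y n).support) :
    π.Reachable x y s.1 := by
  obtain rfl := π.length_of_mem_support_run x y n s h
  exact ⟨s.2.1, s.2.2, h⟩

theorem Reachable.of_append {π : Protocol X Y A B} {x : X} {y : Y} {τ σ : List (List Bool)}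
    (h : π.Reachable x y (τ ++ σ)) : π.Reachable x y τ := by
  induction σ using List.reverseRecOn with
  | nil => simpa using h
  | append_singleton σ m ih =>
    apply ih
    obtain ⟨a, b, h⟩ := h
    rw [← List.append_assoc, List.length_append, List.length_singleton] at h
    obtain ⟨s', h', hs⟩ := (PMF.mem_support_bind_iff _ _ _).1 h
    obtain ⟨m', hm⟩ := π.exists_append_of_mem_support_step x y s' _ hs
    rw [List.append_inj_left' hm rfl]
    exact π.reachable_of_mem_support_run x y _ s' h'

theorem mul_tsum_ne_zero {ι : Type*} {f g : ι → ENNReal} (i : ι) (h : f i * g i ≠ 0) :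
    ∑' i, f i * g i ≠ 0 := fun h0 => h (ENNReal.tsum_eq_zero.1 h0 i)

/-- If both parties could have continued a common history, the party whose turn it is decides. -/
theorem Reachable.swap {π : Protocol X Y A B} {x x' : X} {y y' : Y} {τ : List (List Bool)}
    {m m' : List Bool} (h : π.Reachable x y (τ ++ [m])) (h' : π.Reachable x' y' (τ ++ [m'])) :
    π.Reachable x y' (τ ++ [m]) ∨ π.Reachable x y' (τ ++ [m']) := by
  obtain ⟨F, G, hFG⟩ := π.exists_run_eq_mul τ.length
  obtain ⟨a, b, h⟩ := h
  obtain ⟨a', b', h'⟩ := h'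
  rw [PMF.mem_support_iff, List.length_append, List.length_singleton] at h h'
  -- If party 1 moves, then `x` can send `m` after `τ` against any `y'` compatible with `τ`; if
  -- party 2 moves, `y'` can send `m'`.
  by_cases ht : π.IsTurn1 τ.length
  · left
    rw [run_succ_append_of_isTurn1 _ _ _ _ _ _ _ _ ht, Ne, ENNReal.tsum_eq_zero, not_forall]
      at h h'
    obtain ⟨c, hc⟩ := h
    obtain ⟨c', hc'⟩ := h'
    refine ⟨a, b', ?_⟩
    rw [PMF.mem_support_iff, List.length_append, List.length_singleton,
      run_succ_append_of_isTurn1 _ _ _ _ _ _ _ _ ht]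
    refine mul_tsum_ne_zero c ?_
    simp only [hFG, mul_eq_zero, not_or] at hc hc' ⊢
    simp only [Ne, mul_eq_zero, not_or]
    tauto
  · right
    rw [run_succ_append_of_not_isTurn1 _ _ _ _ _ _ _ _ ht, Ne, ENNReal.tsum_eq_zero, not_forall]
      at h h'
    obtain ⟨c, hc⟩ := h
    obtain ⟨c', hc'⟩ := h'
    refine ⟨a, b', ?_⟩
    rw [PMF.mem_support_iff, List.length_append, List.length_singleton,
      run_succ_append_of_not_isTurn1 _ _ _ _ _ _ _ _ ht]
    refine mul_tsum_ne_zero c' ?_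
    simp only [hFG, mul_eq_zero, not_or] at hc hc' ⊢
    simp only [Ne, mul_eq_zero, not_or]
    tauto

/-- On a rectangle of inputs in the support, a transcript parses uniquely into messages. -/
theorem SelfTerminating.eq_of_flatten_eq {π : Protocol X Y A B} {p : PMF (X × Y)}
    (hπ : π.SelfTerminating p) {x x' : X} {y y' : Y} (h1 : (x, y) ∈ p.support)
    (h2 : (x', y') ∈ p.support) (h3 : (x, y') ∈ p.support) (ρ ρ' σ : List (List Bool))
    (hl : ρ.length = ρ'.length) (hf : ρ.flatten = ρ'.flatten)
    (h : π.Reachable x y (σ ++ ρ)) (h' : π.Reachable x' y' (σ ++ ρ')) : ρ = ρ' := by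
  induction ρ generalizing ρ' σ with
  | nil => exact (List.length_eq_zero_iff.1 hl.symm).symm
  | cons m ρ ih =>
    cases ρ' with
    | nil => simp at hl
    | cons m' ρ' =>
      rw [← List.singleton_append, ← List.append_assoc] at h h'
      have hm := h.of_append
      have hm' := h'.of_append
      rw [List.flatten_cons, List.flatten_cons] at hf
      have hpre : m <+: m' ∨ m' <+: m :=
        List.prefix_or_prefix_of_prefix (l₃ := m' ++ ρ'.flatten)
          (hf ▸ List.prefix_append _ _) (List.prefix_append _ _)
      -- Prefix-freeness does not compare `(x, y)` with `(x', y')` directly. The corner `(x, y')`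
      -- can send `m` or `m'`, and it shares one input with each of them.
      have hmm : m = m' := by
        rcases hm.swap hm' with hs | hs
        · rcases hpre with hpre | hpre
          · exact hπ _ _ _ _ h3 h2 (Or.inr rfl) _ _ _ hs hm' hpre
          · exact (hπ _ _ _ _ h2 h3 (Or.inr rfl) _ _ _ hm' hs hpre).symm
        · rcases hpre with hpre | hpre
          · exact hπ _ _ _ _ h1 h3 (Or.inl rfl) _ _ _ hm hs hpre
          · exact (hπ _ _ _ _ h3 h1 (Or.inl rfl) _ _ _ hs hm hpre).symm
      subst hmm
      have hρ := ih ρ' (σ ++ [m]) (by simpa using hl) (List.append_cancel_left hf) h h'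
      exact congrArg (List.cons m) hρ

/-- The probability that within `n` moves both parties have halted with outputs `a` and `b` and
transcript `m`. -/
noncomputable def outcomeProbWithin (π : Protocol X Y A B) (n : ℕ) (x : X) (y : Y) (a : A) (b : B)
    (m : List Bool) : ENNReal :=
  (π.run x y n).map (fun s => (s.1.flatten, s.2)) (m, some a, some b)

open Classical in
theorem outcomeProbWithin_eq_tsum (π : Protocol X Y A B) (n : ℕ) (x : X) (y : Y) (a : A) (b : B)
    (m : List Bool) : π.outcomeProbWithin n x y a b m =
      ∑' τ, if m = τ.flatten then π.run x y n (τ, some a, some b) else 0 := by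
  rw [outcomeProbWithin, PMF.map_apply, ENNReal.tsum_prod']
  refine tsum_congr fun τ => ?_
  rw [tsum_eq_single (some a, some b)]
  · simp
  · intro s hs
    simp [hs.symm]

/-- Both sides are double sums over parsings of `m`. On the left only the diagonal survives, by
unique parsing; there the terms agree by the product form, and the other terms on the right are
nonnegative. Three corners of the rectangle suffice for this direction. -/
theorem outcomeProbWithin_mul_le {π : Protocol X Y A B} {p : PMF (X × Y)}
    (hπ : π.SelfTerminating p) {x x' : X} {y y' : Y} (h1 : (x, y) ∈ p.support)
    (h2 : (x', y') ∈ p.support) (h3 : (x, y') ∈ p.support) (n : ℕ) (a a' : A) (b b' : B)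
    (m : List Bool) :
    π.outcomeProbWithin n x y a b m * π.outcomeProbWithin n x' y' a' b' m ≤
      π.outcomeProbWithin n x y' a b' m * π.outcomeProbWithin n x' y a' b m := by
  classical
  obtain ⟨F, G, hFG⟩ := π.exists_run_eq_mul n
  simp only [outcomeProbWithin_eq_tsum, ← ENNReal.tsum_mul_left, ← ENNReal.tsum_mul_right]
  refine ENNReal.tsum_le_tsum fun τ' => ENNReal.tsum_le_tsum fun τ => ?_
  by_cases ht : m = τ.flatten
  swap
  · simp [ht]
  by_cases ht' : m = τ'.flatten
  swap
  · simp [ht']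
  rw [if_pos ht, if_pos ht', if_pos ht, if_pos ht']
  by_cases h0 : π.run x y n (τ, some a, some b) = 0
  · simp [h0]
  by_cases h0' : π.run x' y' n (τ', some a', some b') = 0
  · simp [h0']
  obtain rfl : τ = τ' := hπ.eq_of_flatten_eq h1 h2 h3 τ τ' []
    ((π.length_of_mem_support_run _ _ _ _ h0).trans
      (π.length_of_mem_support_run _ _ _ _ h0').symm) (ht.symm.trans ht')
    (π.reachable_of_mem_support_run _ _ _ _ h0) (π.reachable_of_mem_support_run _ _ _ _ h0')
  simp only [hFG]
  exact le_of_eq (by ring)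

theorem outcomeProbWithin_mono (π : Protocol X Y A B) (x : X) (y : Y) (a : A) (b : B)
    (m : List Bool) : Monotone fun n => π.outcomeProbWithin n x y a b m := by
  classical
  refine monotone_nat_of_le_succ fun n => ?_
  unfold outcomeProbWithin
  rw [run, PMF.map_bind, PMF.bind_apply, PMF.map_apply]
  refine ENNReal.tsum_le_tsum fun s => ?_
  split_ifs with h
  · obtain ⟨τ, a₁, b₁⟩ := s
    simp only [Prod.mk.injEq] at h
    obtain ⟨rfl, rfl, rfl⟩ := h
    -- Once both parties have halted, a move only appends an empty message, which does not change
    -- the transcript.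
    have : π.step x y (τ, some a, some b) = PMF.pure (τ ++ [[]], some a, some b) := by
      unfold step; split_ifs <;> rfl
    rw [this, PMF.pure_map]
    simp
  · exact zero_le

theorem outcomeProb_mul_le {π : Protocol X Y A B} {p : PMF (X × Y)}
    (hπ : π.SelfTerminating p) {x x' : X} {y y' : Y} (h1 : (x, y) ∈ p.support)
    (h2 : (x', y') ∈ p.support) (h3 : (x, y') ∈ p.support) (a a' : A) (b b' : B)
    (m : List Bool) :
    π.outcomeProb x y a b m * π.outcomeProb x' y' a' b' m ≤
      π.outcomeProb x y' a b' m * π.outcomeProb x' y a' b m := by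
  have e : ∀ x y a b, π.outcomeProb x y a b m = ⨆ n, π.outcomeProbWithin n x y a b m :=
    fun _ _ _ _ => rfl
  rw [e x y, e x' y', ENNReal.iSup_mul]
  refine iSup_le fun n => ?_
  rw [ENNReal.mul_iSup]
  refine iSup_le fun k => ?_
  calc _ ≤ π.outcomeProbWithin (max n k) x y a b m *
        π.outcomeProbWithin (max n k) x' y' a' b' m :=
        mul_le_mul' (π.outcomeProbWithin_mono x y a b m (le_max_left n k))
          (π.outcomeProbWithin_mono x' y' a' b' m (le_max_right n k))
    _ ≤ _ := outcomeProbWithin_mul_le hπ h1 h2 h3 _ _ _ _ _ _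
    _ ≤ _ := mul_le_mul' (le_iSup (fun n => π.outcomeProbWithin n x y' a b' m) _)
        (le_iSup (fun n => π.outcomeProbWithin n x' y a' b m) (max n k))

/-- The two-by-two minors of the outcome probabilities vanish on rectangles of inputs. -/
theorem outcomeProb_mul_comm {π : Protocol X Y A B} {p : PMF (X × Y)}
    (hπ : π.SelfTerminating p) {x x' : X} {y y' : Y} (h1 : (x, y) ∈ p.support)
    (h2 : (x', y') ∈ p.support) (h3 : (x, y') ∈ p.support) (h4 : (x', y) ∈ p.support)
    (a a' : A) (b b' : B) (m : List Bool) :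
    π.outcomeProb x y a b m * π.outcomeProb x' y' a' b' m =
      π.outcomeProb x y' a b' m * π.outcomeProb x' y a' b m :=
  (outcomeProb_mul_le hπ h1 h2 h3 _ _ _ _ _).antisymm (outcomeProb_mul_le hπ h3 h4 h1 _ _ _ _ _)

end Protocol

end Tension

/-! ### Couplings through channels, and vanishing minors. -/

namespace Tension

section Kernel

variable {Ω α β γ : Type*}

/-- The joint law of a sample of `P` and an output of the channel `κ` on it. -/
noncomputable def extend (P : PMF Ω) (κ : Ω → PMF β) : PMF (Ω × β) :=
  P.bind fun w => (κ w).map (Prod.mk w)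

theorem extend_apply (P : PMF Ω) (κ : Ω → PMF β) (w : Ω) (b : β) :
    extend P κ (w, b) = P w * κ w b := by
  rw [extend, PMF.bind_apply, tsum_eq_single w]
  · rw [map_apply_of_injective _ (Prod.mk_right_injective w)]
  · intro w' h
    rw [mul_eq_zero]
    right
    by_contra h0
    obtain ⟨b', -, hb⟩ := (PMF.mem_support_map_iff _ _ _).1 h0
    exact h (congrArg Prod.fst hb)

theorem extend_map_fst (P : PMF Ω) (κ : Ω → PMF β) : (extend P κ).map Prod.fst = P := by
  ext w
  rw [map_fst_apply]
  simp only [extend_apply, ENNReal.tsum_mul_left, PMF.tsum_coe, mul_one]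

theorem extend_map (P : PMF Ω) (κ : α → PMF β) (g : Ω → γ) (h : γ → α) :
    (extend P fun w => κ (h (g w))).map (fun w => (g w.1, w.2)) =
      extend (P.map g) fun v => κ (h v) := by
  simp only [extend, PMF.map_bind, PMF.bind_map, PMF.map_comp]
  rfl

theorem exists_eq_extend (P : PMF (α × β)) : ∃ κ : α → PMF β, P = extend (P.map Prod.fst) κ := by
  classical
  obtain ⟨⟨-, b₀⟩, -⟩ := P.support_nonempty
  -- The conditional law of the second coordinate; at null points any value will do.
  refine ⟨fun a => if h : P.map Prod.fst a = 0 then PMF.pure b₀ else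
    PMF.normalize (fun b => P (a, b)) (by rwa [← map_fst_apply])
      (by rw [← map_fst_apply]; exact PMF.apply_ne_top _ _), ?_⟩
  ext ⟨a, b⟩
  rw [extend_apply]
  split_ifs with h
  · rw [h, zero_mul]
    rw [map_fst_apply, ENNReal.tsum_eq_zero] at h
    exact h b
  · rw [PMF.normalize_apply, ← map_fst_apply, mul_left_comm,
      ENNReal.mul_inv_cancel h (PMF.apply_ne_top _ _), mul_one]

theorem minors_of_condMutualInfo_nonpos [Finite α] (P : PMF Ω) (A : Ω → α) (B : Ω → β)
    (C : Ω → γ) (h : condMutualInfo P A B C ≤ 0) (a a' : α) (b b' : β) (c : γ) :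
    P.map (fun ω => (A ω, B ω, C ω)) (a, b, c) * P.map (fun ω => (A ω, B ω, C ω)) (a', b', c) =
      P.map (fun ω => (A ω, B ω, C ω)) (a, b', c) *
        P.map (fun ω => (A ω, B ω, C ω)) (a', b, c) := by
  have key := map_mul_map_of_condMutualInfo_nonpos P A B C h
  by_cases hc : P.map C c = 0
  · have hz : ∀ a b, P.map (fun ω => (A ω, B ω, C ω)) (a, b, c) = 0 := fun a b => by
      have h1 := map_pair_le P A (fun ω => (B ω, C ω)) a (b, c)
      have h2 := map_pair_le P B C b c
      exact le_zero_iff.1 (h1.trans (h2.trans hc.le))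
    simp only [hz]
  · have ht : P.map C c ≠ ⊤ := PMF.apply_ne_top _ _
    refine (ENNReal.mul_left_inj (mul_ne_zero hc hc) (ENNReal.mul_ne_top ht ht)).1 ?_
    have k : ∀ a b a' b', P.map (fun ω => (A ω, B ω, C ω)) (a, b, c) *
        P.map (fun ω => (A ω, B ω, C ω)) (a', b', c) * (P.map C c * P.map C c) =
        P.map (fun ω => (A ω, C ω)) (a, c) * P.map (fun ω => (B ω, C ω)) (b, c) *
          (P.map (fun ω => (A ω, C ω)) (a', c) * P.map (fun ω => (B ω, C ω)) (b', c)) :=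
      fun a b a' b' => by rw [mul_mul_mul_comm, key, key]
    rw [k, k]
    ring

theorem condMutualInfo_eq_zero_of_determined (P : PMF Ω) (A : Ω → α) (B : Ω → β) (C : Ω → γ)
    (h : ∀ ω ω', C ω = C ω' → B ω = B ω') : condMutualInfo P A B C = 0 := by
  refine condMutualInfo_eq_zero_of_minors P A B C fun a b a' b' c => ?_
  by_cases hb : b = b'
  · rw [hb]
  have hz : ∀ a a', P.map (fun ω => (A ω, B ω, C ω)) (a, b, c) *
      P.map (fun ω => (A ω, B ω, C ω)) (a', b', c) = 0 := by
    intro a a'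
    by_contra h0
    obtain ⟨h1, h2⟩ := mul_ne_zero_iff.1 h0
    obtain ⟨ω, -, hω⟩ := (PMF.mem_support_map_iff _ _ _).1 h1
    obtain ⟨ω', -, hω'⟩ := (PMF.mem_support_map_iff _ _ _).1 h2
    simp only [Prod.mk.injEq] at hω hω'
    exact hb (hω.2.1.symm.trans ((h ω ω' (hω.2.2.trans hω'.2.2.symm)).trans hω'.2.1))
  rw [hz, mul_comm, hz]

end Kernel

/-! ### Wyner-tension of the inputs and of the views. -/

section Main

variable {X Y Z : Type*}

theorem wynerTension_le_of_mem {α β : Type*} {p : PMF (α × β)} {r : ℝ × ℝ}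
    (h : r ∈ tensionSlice p 0) : wynerTension p ≤ r.1 + r.2 := by
  refine csInf_le ⟨0, ?_⟩ ⟨r, h, rfl⟩
  rintro t ⟨r, ⟨h1, h2, -⟩, rfl⟩
  exact add_nonneg h1 h2

theorem tensionSlice_nonempty {α β : Type*} [Finite β] (p : PMF (α × β)) :
    (tensionSlice p 0).Nonempty := by
  obtain ⟨e, he⟩ := Countable.exists_injective_nat β
  -- The witness is `Q = B`, encoded in `ℕ`: given `Q`, the second variable is constant.
  let P : PMF (α × β × ℕ) := p.map fun ω => (ω.1, ω.2, e ω.2)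
  refine ⟨(condMutualInfo P (fun ω => ω.2.1) (fun ω => ω.2.2) (fun ω => ω.1),
    condMutualInfo P (fun ω => ω.1) (fun ω => ω.2.2) (fun ω => ω.2.1)),
    condMutualInfo_nonneg _ _ _ _, condMutualInfo_nonneg _ _ _ _, P, ?_, le_rfl, le_rfl, ?_⟩
  · rw [PMF.map_comp]
    exact PMF.map_id p
  · rw [condMutualInfo_map]
    exact (condMutualInfo_eq_zero_of_determined _ _ _ _ fun ω ω' h => he h).le

theorem wynerTension_nonpos_of_independent {α β : Type*} (p : PMF (α × β))
    (hp : Independent p) : wynerTension p ≤ 0 := by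
  have h : ((0, 0) : ℝ × ℝ) ∈ tensionSlice p 0 := by
    refine ⟨le_rfl, le_rfl, p.map fun ω => (ω.1, ω.2, 0), ?_, ?_, ?_, ?_⟩
    · rw [PMF.map_comp]
      exact PMF.map_id p
    · rw [condMutualInfo_map]
      exact (condMutualInfo_eq_zero_of_determined _ _ _ _ fun _ _ _ => rfl).le
    · rw [condMutualInfo_map]
      exact (condMutualInfo_eq_zero_of_determined _ _ _ _ fun _ _ _ => rfl).le
    · rw [condMutualInfo_map]
      refine (condMutualInfo_eq_zero_of_minors _ _ _ _ fun a b a' b' c => ?_).le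
      by_cases hc : c = 0
      · have e : ∀ a b, p.map (fun ω => (ω.1, ω.2, (0 : ℕ))) (a, b, 0) = p (a, b) := fun a b =>
          map_apply_of_injective p (fun u v h => by simpa [Prod.ext_iff] using h) (a, b)
        simp only [hc, e, hp _ _]
        ring
      · have e : ∀ a b, p.map (fun ω => (ω.1, ω.2, (0 : ℕ))) (a, b, c) = 0 := fun a b => by
          by_contra h0
          obtain ⟨ω, -, hω⟩ := (PMF.mem_support_map_iff _ _ _).1 h0
          simp only [Prod.mk.injEq] at hω
          exact hc hω.2.2.symm
        simp only [e]
  simpa using wynerTension_le_of_mem h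

/-- A protocol for `Z` and a random variable `Q` for the Wyner-tension of the inputs combine to a
random variable for the Wyner-tension of the views. -/
theorem mem_tensionSlice_of_mem_infoRegion [Finite X] [Finite Y] [Finite Z] (p : PMF (X × Y × Z))
    {r s : ℝ × ℝ} (hr : r ∈ infoRegion (p.map fun ω => (ω.1, ω.2.1, ω.2.2, ω.2.2)))
    (hs : s ∈ tensionSlice (p.map fun ω => (ω.1, ω.2.1)) 0) :
    (s.1 + r.2, s.2 + r.1) ∈
      tensionSlice (p.map fun ω => ((ω.1, ω.2.2), (ω.2.1, ω.2.2))) 0 := by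
  obtain ⟨hr1, hr2, π, P, hπ, hexec, hP, hX, hY⟩ := hr
  obtain ⟨hs1, hs2, R, hR, hYQ, hXQ, hXY⟩ := hs
  dsimp only at hYQ hXQ hXY
  have hp : (p.map fun ω => (ω.1, ω.2.1, ω.2.2, ω.2.2)).map (fun ω => (ω.1, ω.2.1)) =
      p.map fun ω => (ω.1, ω.2.1) := by
    rw [PMF.map_comp]; rfl
  rw [hp] at hπ hexec
  have hPV : P.map (fun w => (w.1, w.2.1)) = p.map fun ω => (ω.1, ω.2.1) := by
    rw [← hp, ← hP, PMF.map_comp]; rfl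
  obtain ⟨κ, hκ⟩ := exists_eq_extend (R.map fun ω => ((ω.1, ω.2.1), ω.2.2))
  have hRV : (R.map fun ω => ((ω.1, ω.2.1), ω.2.2)).map Prod.fst =
      p.map fun ω => (ω.1, ω.2.1) := by
    rw [← hR, PMF.map_comp]; rfl
  rw [hRV] at hκ
  have hRapp : ∀ x y q, R (x, y, q) = p.map (fun ω => (ω.1, ω.2.1)) (x, y) * κ (x, y) q := by
    intro x y q
    rw [← extend_apply, ← hκ]
    exact (map_apply_of_injective R (f := fun ω => ((ω.1, ω.2.1), ω.2.2))
      (fun u v h => by simpa [Prod.ext_iff, and_assoc] using h) (x, y, q)).symm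
  -- The coupling: `Q` is drawn from its conditional law given `(X, Y)`, without regard to outputs
  -- and transcript.
  let J : PMF ((X × Y × Z × Z × List Bool) × ℕ) := extend P fun w => κ (w.1, w.2.1)
  have hJP : J.map Prod.fst = P := extend_map_fst P _
  have hJR : J.map (fun ω => (ω.1.1, ω.1.2.1, ω.2)) = R := by
    have h := extend_map P κ (fun w => (w.1, w.2.1)) id
    simp only [id] at h
    rw [hPV, ← hκ] at h
    have h' := congrArg (PMF.map fun v : (X × Y) × ℕ => (v.1.1, v.1.2, v.2)) h
    rw [PMF.map_comp, PMF.map_comp] at h'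
    exact h'.trans (PMF.map_id R)
  have hJ : ∀ x y a b m q, J ((x, y, a, b, m), q) = R (x, y, q) * π.outcomeProb x y a b m := by
    intro x y a b m q
    rw [hRapp, extend_apply, hexec]
    exact mul_right_comm _ _ _
  have hRminor : ∀ x x' y y' q, R (x, y, q) * R (x', y', q) = R (x, y', q) * R (x', y, q) := by
    have := minors_of_condMutualInfo_nonpos R _ _ _ hXY
    have e : R.map (fun ω => (ω.1, ω.2.1, ω.2.2)) = R := PMF.map_id R
    simpa only [e] using this
  have hsupp : ∀ x y q, R (x, y, q) ≠ 0 → (x, y) ∈ (p.map fun ω => (ω.1, ω.2.1)).support := by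
    intro x y q h
    rw [hRapp] at h
    exact (mul_ne_zero_iff.1 h).1
  have hJminor : ∀ x x' y y' a a' b b' m q,
      J ((x, y, a, b, m), q) * J ((x', y', a', b', m), q) =
        J ((x, y', a, b', m), q) * J ((x', y, a', b, m), q) := by
    intro x x' y y' a a' b b' m q
    simp only [hJ]
    rw [mul_mul_mul_comm, mul_mul_mul_comm (R (x, y', q)), ← hRminor x x' y y' q]
    -- If two opposite corners are possible given `q`, the minor identity for `R` makes all four
    -- possible, which is the rectangle that `outcomeProb_mul_comm` requires.
    by_cases h0 : R (x, y, q) * R (x', y', q) = 0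
    · rw [h0, zero_mul, zero_mul]
    · obtain ⟨h1, h2⟩ := mul_ne_zero_iff.1 h0
      rw [hRminor] at h0
      obtain ⟨h3, h4⟩ := mul_ne_zero_iff.1 h0
      rw [Protocol.outcomeProb_mul_comm hπ (hsupp _ _ _ h1) (hsupp _ _ _ h2) (hsupp _ _ _ h3)
        (hsupp _ _ _ h4)]
  have hAB : ∀ ω ∈ J.support, ω.1.2.2.1 = ω.1.2.2.2.1 := by
    intro ω hω
    have h1 : ω.1 ∈ P.support := by
      rw [← hJP]
      exact (PMF.mem_support_map_iff _ _ _).2 ⟨ω, hω, rfl⟩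
    have h2 := (PMF.mem_support_map_iff (fun ω : X × Y × Z × Z × List Bool =>
      (ω.1, ω.2.1, ω.2.2.1, ω.2.2.2.1)) P _).2 ⟨ω.1, h1, rfl⟩
    rw [hP] at h2
    obtain ⟨v, -, hv⟩ := (PMF.mem_support_map_iff _ _ _).1 h2
    simp only [Prod.mk.injEq] at hv
    exact hv.2.2.1.symm.trans hv.2.2.2
  have hdet : ∀ ω ∈ J.support, ∀ ω' ∈ J.support, ω.2 = ω'.2 → ω.1.2.2.2.2 = ω'.1.2.2.2.2 →
      ω.1.2.2.1 = ω'.1.2.2.1 := by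
    rintro ⟨⟨x, y, a, b, m⟩, q⟩ h ⟨⟨x', y', a', b', m'⟩, q'⟩ h' hq hm
    dsimp only at hq hm ⊢
    subst hq hm
    -- By the minor identity the mixed point with party 1's view from `ω` and party 2's from `ω'` is
    -- also possible. Outputs agree there, so `a = b'`, and `b' = a'`.
    have h0 := mul_ne_zero h h'
    rw [hJminor] at h0
    exact (hAB _ (mul_ne_zero_iff.1 h0).1).trans (hAB _ h').symm
  obtain ⟨e⟩ : Nonempty (ℕ × List Bool ≃ ℕ) := nonempty_equiv_of_countable
  have hN : ∀ ω ω' : (X × Y × Z × Z × List Bool) × ℕ,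
      e (ω.2, ω.1.2.2.2.2) = e (ω'.2, ω'.1.2.2.2.2) ↔
        ω.2 = ω'.2 ∧ ω.1.2.2.2.2 = ω'.1.2.2.2.2 := fun ω ω' => by
    rw [e.injective.eq_iff, Prod.mk.injEq]
  have hQM : ∀ ω : (X × Y × Z × Z × List Bool) × ℕ,
      J.map (fun ω => ((ω.1.1, ω.1.2.1), ω.2, ω.1.2.2.2.2))
        ((ω.1.1, ω.1.2.1), ω.2, ω.1.2.2.2.2) *
        J.map (fun ω => (ω.1.1, ω.1.2.1)) (ω.1.1, ω.1.2.1) =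
      J.map (fun ω => ((ω.1.1, ω.1.2.1), ω.2)) ((ω.1.1, ω.1.2.1), ω.2) *
        J.map (fun ω => ((ω.1.1, ω.1.2.1), ω.1.2.2.2.2))
          ((ω.1.1, ω.1.2.1), ω.1.2.2.2.2) := by
    intro ω
    have h1 : J.map (fun ω => ((ω.1.1, ω.1.2.1), ω.2, ω.1.2.2.2.2))
        ((ω.1.1, ω.1.2.1), ω.2, ω.1.2.2.2.2) =
        J.map (fun ω => (((ω.1.1, ω.1.2.1), ω.1.2.2.2.2), ω.2))
          (((ω.1.1, ω.1.2.1), ω.1.2.2.2.2), ω.2) :=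
      map_apply_congr J _ _ ω fun ω' _ => by
        simp only [Prod.ext_iff]
        tauto
    have h2 := extend_map P κ (fun w => (w.1, w.2.1)) id
    have h3 := extend_map P κ (fun w => ((w.1, w.2.1), w.2.2.2.2)) Prod.fst
    simp only [id] at h2 h3
    have h4 : J.map (fun ω => (ω.1.1, ω.1.2.1)) = P.map fun w => (w.1, w.2.1) := by
      conv_rhs => rw [← hJP, PMF.map_comp]
      rfl
    have h5 : J.map (fun ω => ((ω.1.1, ω.1.2.1), ω.1.2.2.2.2)) =
        P.map fun w => ((w.1, w.2.1), w.2.2.2.2) := by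
      conv_rhs => rw [← hJP, PMF.map_comp]
      rfl
    rw [h1, h2, h3, h4, h5, extend_apply, extend_apply]
    ring
  have hX' : condMutualInfo J (fun ω => ω.1.1) (fun ω => ω.1.2.2.2.2) (fun ω => ω.1.2.1) ≤ r.1 := by
    rwa [← hJP, condMutualInfo_map] at hX
  have hY' : condMutualInfo J (fun ω => ω.1.2.1) (fun ω => ω.1.2.2.2.2) (fun ω => ω.1.1) ≤ r.2 := by
    rwa [← hJP, condMutualInfo_map] at hY
  rw [← hJR, condMutualInfo_map] at hYQ hXQ
  -- The coordinates cross: the first rate of a tension region bounds what is learnt about the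
  -- second variable, the first rate of `infoRegion` what is learnt about `X`.
  refine ⟨add_nonneg hs1 hr2, add_nonneg hs2 hr1,
    J.map fun ω => ((ω.1.1, ω.1.2.2.1), (ω.1.2.1, ω.1.2.2.2.1), e (ω.2, ω.1.2.2.2.2)),
    ?_, ?_, ?_, ?_⟩
  · have h := congrArg (PMF.map fun v : X × Y × Z × Z => ((v.1, v.2.2.1), (v.2.1, v.2.2.2))) hP
    rw [← hJP, PMF.map_comp, PMF.map_comp, PMF.map_comp] at h
    rw [PMF.map_comp]
    exact h
  · rw [condMutualInfo_map]
    refine (condMutualInfo_pair_le J (fun ω => ω.1.1) (fun ω => ω.1.2.1) (fun ω => ω.1.2.2.1)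
      (fun ω => ω.1.2.2.2.1) (fun ω => ω.2) (fun ω => ω.1.2.2.2.2)
      (fun ω => e (ω.2, ω.1.2.2.2.2)) (fun ω => (ω.1.1, ω.1.2.1)) hAB hdet hN
      (fun ω ω' => Prod.mk.injEq _ _ _ _ ▸ Iff.rfl) hQM).trans (add_le_add hYQ hY')
  · rw [condMutualInfo_map]
    refine (condMutualInfo_pair_le J (fun ω => ω.1.2.1) (fun ω => ω.1.1) (fun ω => ω.1.2.2.2.1)
      (fun ω => ω.1.2.2.1) (fun ω => ω.2) (fun ω => ω.1.2.2.2.2)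
      (fun ω => e (ω.2, ω.1.2.2.2.2)) (fun ω => (ω.1.1, ω.1.2.1))
      (fun ω h => (hAB ω h).symm)
      (fun ω h ω' h' hq hm => by rw [← hAB ω h, ← hAB ω' h', hdet ω h ω' h' hq hm]) hN
      (fun ω ω' => by simp only [Prod.mk.injEq]; tauto) hQM).trans (add_le_add hXQ hX')
  · rw [condMutualInfo_map]
    refine (condMutualInfo_eq_zero_of_minors J _ _ _ ?_).le
    rintro ⟨x, a⟩ ⟨y, b⟩ ⟨x', a'⟩ ⟨y', b'⟩ c
    obtain ⟨⟨q, m⟩, rfl⟩ := e.surjective c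
    have hi : ∀ x a y b, J.map (fun ω => ((ω.1.1, ω.1.2.2.1), (ω.1.2.1, ω.1.2.2.2.1),
        e (ω.2, ω.1.2.2.2.2))) ((x, a), (y, b), e (q, m)) = J ((x, y, a, b, m), q) :=
      fun x a y b => map_apply_of_injective J (f := fun ω => ((ω.1.1, ω.1.2.2.1),
        (ω.1.2.1, ω.1.2.2.2.1), e (ω.2, ω.1.2.2.2.2)))
        (fun u v h => by
          simp only [Prod.mk.injEq, hN] at h
          simp only [Prod.ext_iff]
          tauto) ((x, y, a, b, m), q)
    simp only [hi]
    exact hJminor x x' y y' a a' b b' m q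

end Main

end Tension

/-! ### Existence of a protocol computing `Z`. -/

namespace Tension

open Classical in
/-- A prefix-free code with words of equal length. -/
theorem exists_injective_code (α : Type*) [Finite α] :
    ∃ (n : ℕ) (c : α → List Bool), Function.Injective c ∧ ∀ a, (c a).length = n := by
  obtain ⟨n, ⟨e⟩⟩ := Finite.exists_equiv_fin α
  refine ⟨n, fun a => List.ofFn fun i => decide (e a = i), fun a b h => ?_, fun a => by simp⟩
  have := congrFun (List.ofFn_injective h) (e b)
  simpa using this

variable {X Y Z : Type*}

/-- The protocol in which party 1 reveals its input, and party 2 samples the output and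
announces it. -/
noncomputable def revealProtocol [Nonempty X] [Nonempty Z] (cX : X → List Bool)
    (cZ : Z → List Bool) (κ : X × Y → PMF Z) : Protocol X Y Z Z where
  first := true
  party1 x τ := match τ with
    | [] => PMF.pure (cX x, none)
    | [_, m] => PMF.pure ([], some (Function.invFun cZ m))
    | _ => PMF.pure ([], none)
  party2 y τ := match τ with
    | [m] => (κ (Function.invFun cX m, y)).map fun z => (cZ z, some z)
    | _ => PMF.pure ([], none)

section Reveal

variable [Nonempty X] [Nonempty Z] {cX : X → List Bool} {cZ : Z → List Bool} (κ : X × Y → PMF Z)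

theorem revealProtocol_run_one (x : X) (y : Y) :
    (revealProtocol cX cZ κ).run x y 1 = PMF.pure ([cX x], none, none) := by
  simp [Protocol.run, Protocol.step, Protocol.IsTurn1, revealProtocol, PMF.pure_map]

theorem revealProtocol_run_two (hX : Function.Injective cX) (x : X) (y : Y) :
    (revealProtocol cX cZ κ).run x y 2 =
      (κ (x, y)).map fun z => ([cX x, cZ z], none, some z) := by
  rw [Protocol.run, revealProtocol_run_one, PMF.pure_bind]
  simp [Protocol.step, Protocol.IsTurn1, revealProtocol, PMF.map_comp,
    Function.leftInverse_invFun hX x, Function.comp_def]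

/-- Party 2 halts at the second move and party 1 at the third, whose message is already empty; hence
`n + 1` empty messages after `n + 3` moves. -/
theorem revealProtocol_run_add_three (hX : Function.Injective cX) (hZ : Function.Injective cZ)
    (x : X) (y : Y) (n : ℕ) : (revealProtocol cX cZ κ).run x y (n + 3) =
      (κ (x, y)).map fun z => ([cX x, cZ z] ++ List.replicate (n + 1) [], some z, some z) := by
  induction n with
  | zero =>
    rw [Protocol.run, revealProtocol_run_two κ hX, PMF.bind_map]
    simp [Protocol.step, Protocol.IsTurn1, revealProtocol,
      Function.leftInverse_invFun hZ _, Function.comp_def, PMF.map]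
  | succ n ih =>
    rw [add_right_comm, Protocol.run, ih, PMF.bind_map, PMF.map]
    congr 1
    funext z
    have h : [cX x, cZ z] ++ List.replicate (n + 1 + 1) [] =
        ([cX x, cZ z] ++ List.replicate (n + 1) []) ++ [[]] := by
      rw [List.replicate_succ', List.append_assoc]
    simp only [Function.comp_apply, h]
    unfold Protocol.step
    split_ifs <;> rfl

/-- The length of a message depends only on its position, which gives prefix-freeness for all inputs
at once. -/
theorem revealProtocol_length_of_reachable (hX : Function.Injective cX)
    (hZ : Function.Injective cZ) {nX nZ : ℕ} (hnX : ∀ x, (cX x).length = nX)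
    (hnZ : ∀ z, (cZ z).length = nZ) {x : X} {y : Y} {τ : List (List Bool)} {m : List Bool}
    (h : (revealProtocol cX cZ κ).Reachable x y (τ ++ [m])) :
    m.length = if τ.length = 0 then nX else if τ.length = 1 then nZ else 0 := by
  obtain ⟨a, b, h⟩ := h
  rw [List.length_append, List.length_singleton] at h
  match hn : τ.length with
  | 0 =>
    rw [hn, zero_add, revealProtocol_run_one, PMF.mem_support_pure_iff] at h
    obtain rfl := List.length_eq_zero_iff.1 hn
    simp only [List.nil_append, Prod.mk.injEq, List.cons.injEq, and_true] at h
    simp [h.1, hnX]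
  | 1 =>
    rw [hn, revealProtocol_run_two κ hX] at h
    obtain ⟨z, -, hz⟩ := (PMF.mem_support_map_iff _ _ _).1 h
    have h1 : [cX x] ++ [cZ z] = τ ++ [m] := congrArg Prod.fst hz
    have := List.append_inj_right' h1 rfl
    simp only [List.cons.injEq, and_true] at this
    simp [← this, hnZ]
  | n + 2 =>
    rw [hn, revealProtocol_run_add_three κ hX hZ] at h
    obtain ⟨z, -, hz⟩ := (PMF.mem_support_map_iff _ _ _).1 h
    have h1 : [cX x, cZ z] ++ List.replicate (n + 1) [] = τ ++ [m] := congrArg Prod.fst hz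
    rw [List.replicate_succ', ← List.append_assoc] at h1
    have := List.append_inj_right' h1 rfl
    simp only [List.cons.injEq, and_true] at this
    simp [← this]

theorem revealProtocol_selfTerminating (hX : Function.Injective cX)
    (hZ : Function.Injective cZ) {nX nZ : ℕ} (hnX : ∀ x, (cX x).length = nX)
    (hnZ : ∀ z, (cZ z).length = nZ) (p : PMF (X × Y)) :
    (revealProtocol cX cZ κ).SelfTerminating p := by
  intro x x' y y' _ _ _ τ m m' h h' hpre
  exact hpre.eq_of_length ((revealProtocol_length_of_reachable κ hX hZ hnX hnZ h).trans
    (revealProtocol_length_of_reachable κ hX hZ hnX hnZ h').symm)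

theorem revealProtocol_outcomeProb (hX : Function.Injective cX) (hZ : Function.Injective cZ)
    (x : X) (y : Y) (a b : Z) (m : List Bool) :
    (revealProtocol cX cZ κ).outcomeProb x y a b m =
      (κ (x, y)).map (fun z => (cX x ++ cZ z, some z, some z)) (m, some a, some b) := by
  have h3 : ∀ n, (revealProtocol cX cZ κ).outcomeProbWithin (n + 3) x y a b m =
      (κ (x, y)).map (fun z => (cX x ++ cZ z, some z, some z)) (m, some a, some b) := by
    intro n
    rw [Protocol.outcomeProbWithin, revealProtocol_run_add_three κ hX hZ, PMF.map_comp]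
    simp [Function.comp_def]
  refine le_antisymm (iSup_le fun n => ?_) ?_
  · rw [← h3 n]
    exact Protocol.outcomeProbWithin_mono _ x y a b m (Nat.le_add_right n 3)
  · rw [← h3 0]
    exact le_iSup (fun n => (revealProtocol cX cZ κ).outcomeProbWithin n x y a b m) (0 + 3)

end Reveal

/-- Needed because the real infimum of the empty set is 0, which would not be a valid upper bound
for the difference of tensions. -/
theorem infoRegion_nonempty [Finite X] [Finite Z] (p : PMF (X × Y × Z)) :
    (infoRegion (p.map fun ω => (ω.1, ω.2.1, ω.2.2, ω.2.2))).Nonempty := by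
  obtain ⟨⟨x₀, -, z₀⟩, -⟩ := p.support_nonempty
  have : Nonempty X := ⟨x₀⟩
  have : Nonempty Z := ⟨z₀⟩
  obtain ⟨nX, cX, hX, hnX⟩ := exists_injective_code X
  obtain ⟨nZ, cZ, hZ, hnZ⟩ := exists_injective_code Z
  obtain ⟨κ, hκ⟩ := exists_eq_extend (p.map fun ω => ((ω.1, ω.2.1), ω.2.2))
  let P : PMF (X × Y × Z × Z × List Bool) :=
    p.map fun ω => (ω.1, ω.2.1, ω.2.2, ω.2.2, cX ω.1 ++ cZ ω.2.2)
  have hp : (p.map fun ω => (ω.1, ω.2.1, ω.2.2, ω.2.2)).map (fun ω => (ω.1, ω.2.1)) =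
      (p.map fun ω => ((ω.1, ω.2.1), ω.2.2)).map Prod.fst := by
    rw [PMF.map_comp, PMF.map_comp]; rfl
  refine ⟨(condMutualInfo P (fun ω => ω.1) (fun ω => ω.2.2.2.2) (fun ω => ω.2.1),
    condMutualInfo P (fun ω => ω.2.1) (fun ω => ω.2.2.2.2) (fun ω => ω.1)),
    condMutualInfo_nonneg _ _ _ _, condMutualInfo_nonneg _ _ _ _, revealProtocol cX cZ κ, P,
    revealProtocol_selfTerminating κ hX hZ hnX hnZ _, ?_, ?_, le_rfl, le_rfl⟩
  · intro x y a b m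
    rw [revealProtocol_outcomeProb κ hX hZ, hp, PMF.map_apply, PMF.map_apply _ (κ (x, y)),
      ENNReal.tsum_prod', tsum_eq_single x, ENNReal.tsum_prod', tsum_eq_single y,
      ← ENNReal.tsum_mul_left]
    · refine tsum_congr fun z => ?_
      have h : p (x, y, z) =
          (p.map fun ω => ((ω.1, ω.2.1), ω.2.2)).map Prod.fst (x, y) * κ (x, y) z := by
        rw [← extend_apply, ← hκ]
        exact (map_apply_of_injective p (f := fun ω => ((ω.1, ω.2.1), ω.2.2))
          (fun u v h => by simpa [Prod.ext_iff, and_assoc] using h) (x, y, z)).symm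
      rw [h, mul_ite, mul_zero]
      by_cases hz : a = z ∧ b = z ∧ m = cX x ++ cZ z
      · simp [hz]
      · rw [if_neg fun h => hz ?_, if_neg fun h => hz ?_] <;>
          simp only [Prod.mk.injEq, Option.some.injEq] at h <;> tauto
    · intro y' hy
      simp [hy.symm]
    · intro x' hx
      simp [hx.symm]
  · rw [PMF.map_comp]
    rfl

end Tension

theorem mainTheorem3 {X Y Z : Type*} [Finite X] [Finite Y] [Finite Z] (p : PMF (X × Y × Z)) :
    Tension.infoComplexity p ≥
        Tension.wynerTension (p.map fun ω => ((ω.1, ω.2.2), (ω.2.1, ω.2.2))) -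
          Tension.wynerTension (p.map fun ω => (ω.1, ω.2.1)) ∧
      (Tension.Independent (p.map fun ω => (ω.1, ω.2.1)) →
        Tension.infoComplexity p ≥
          Tension.wynerTension (p.map fun ω => ((ω.1, ω.2.2), (ω.2.1, ω.2.2)))) := by
  have key : Tension.infoComplexity p ≥
      Tension.wynerTension (p.map fun ω => ((ω.1, ω.2.2), (ω.2.1, ω.2.2))) -
        Tension.wynerTension (p.map fun ω => (ω.1, ω.2.1)) := by
    obtain ⟨r₀, hr₀⟩ := Tension.infoRegion_nonempty p
    obtain ⟨s₀, hs₀⟩ := Tension.tensionSlice_nonempty (p.map fun ω => (ω.1, ω.2.1))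
    refine le_csInf ⟨_, r₀, hr₀, rfl⟩ ?_
    rintro t ⟨r, hr, rfl⟩
    -- This isolates the tension of the inputs, so that the second infimum can be bounded from below
    -- in turn.
    rw [sub_le_comm]
    refine le_csInf ⟨_, s₀, hs₀, rfl⟩ ?_
    rintro t ⟨s, hs, rfl⟩
    have := Tension.wynerTension_le_of_mem
      (Tension.mem_tensionSlice_of_mem_infoRegion p hr hs)
    dsimp only at this
    linarith
  refine ⟨key, fun h => ?_⟩
  have := Tension.wynerTension_nonpos_of_independent _ h
  linarith
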